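/- **Setting.** Let $\Gamma$ be a metric graph, i.e. a finite graph (loops and multiple edges allowed) in which every edge is identified with a real interval of positive finite length. For a point $v\in\Gamma$ let $T_v(\Gamma)$ be the finite set of outgoing tangent vectors at $v$; the valence of $v$ is $|T_v(\Gamma)|$. For a continuous piecewise linear function $f:\Gamma\to\mathbb R$ with integer slopes let $\mathrm{sl}_\eta(f)\in\mathbb Z$ be its outgoing slope along $\eta$, and put $\mathrm{ord}_v(f)=-\sum_{\eta\in T_v(\Gamma)}\mathrm{sl}_\eta(f)$ and $\mathrm{div}(f)=\sum_v \mathrm{ord}_v(f)\cdot v$. For a divisor $D$ on $\Gamma$ let $R(D)$ be the set of such $f$ with $D+\mathrm{div}(f)\ge 0$. A tropical submodule is a set of functions closed under tropical linear combinations $\min\{f_1+a_1,\dots,f_n+a_n\}$ ($n\ge 1$, $a_i\in\mathbb R$); it is finitely generated if it consists of all tropical linear combinations of finitely many functions. A finite set of functions is tropically dependent if real constants can be added to its members so that at every point of $\Gamma$ the minimum is attained by at least two of them. A *tropical linear series of rank $r\ge 0$* is a pair $(D,\Sigma)$, with $D$ a divisor and $\Sigma\subseteq R(D)$ a finitely generated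 tropical submodule, such that 1. for every effective divisor $E$ of degree $r$ there is $f\in\Sigma$ with $\mathrm{div}(f)+D\ge E$; and 2. every set of $r+2$ functions in $\Sigma$ is tropically dependent. It is *strongly recursive* if moreover (recursively in $r$; a subseries of $(D,\Sigma)$ is a pair $(D,\Sigma')$ with $\Sigma'\subseteq\Sigma$) 3. if $r\ge 1$, every set of $r$ functions in $\Sigma$ is contained in a strongly recursive tropical linear subseries of rank $r-1$; and 4. if $S_1,S_2\subseteq\Sigma$ have sizes $s_1,s_2\le r$ with $s_1+s_2\ge r+2$, then there are strongly recursive tropical linear subseries $\Sigma_1\supseteq S_1$ and $\Sigma_2\supseteq S_2$ of ranks $s_1-1$ and $s_2-1$ such that $\Sigma_1\cap\Sigma_2$ contains a strongly recursive tropical linear series (with the same $D$) of rank $s_1+s_2-r-2$. Let $[r]=\{0,1,\dots,r\}$, and order $[r]^d$ componentwise, so that the meet is the coordinatewise minimum. For $P\subseteq[r]^d$ (a dot array), the rank of $P$ along the $i$-axis is the number of distinct $i$-th coordinates of elements of $P$, minus one; $P$ has rank $s$ if its rank along every axis is $s$, and is rankable if it has some rank. $P$ is totally rankable if $\{\mathbf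 y\in P:\mathbf y\succeq\mathbf x\}$ is rankable for every $\mathbf x\in[r]^d$. A position $\mathbf x\in[r]^d$ is redundant for $P$ if it is the meet of a set of at least two elements of $P$, each of which has at least one coordinate in common with $\mathbf x$; $R(P)$ is the set of redundant positions. A *permutation array of rank $r$ and dimension $d$* is a totally rankable $P\subseteq[r]^d$ of rank $r$ with $P\cap R(P)=\emptyset$, and its *redundant closure* is $\overline P=P\cup R(P)$. **Theorem.** Let $(D,\Sigma)$ be a strongly recursive tropical linear series of rank $r$ on $\Gamma$, let $v\in\Gamma$ be a point of valence $d$, and let $\eta_1,\dots,\eta_d$ be the tangent vectors at $v$, in any order. Then for each $i$ the set of slopes $\{\mathrm{sl}_{\eta_i}(f):f\in\Sigma\}$ has exactly $r+1$ elements $s_{\eta_i}[0]<\cdots<s_{\eta_i}[r]$, and the local array $$\{\mathbf x\in[r]^d:\ \text{there is } f\in\Sigma \text{ with } \mathrm{sl}_{\eta_i}(f)=s_{\eta_i}[x_i]\text{ for all } i\}$$ is the redundant closure of a permutation array of rank $r$ and dimension $d$. -/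

import Mathlib

open Filter Topology

/-- A metric graph: a graph with vertex set `V` and edge set `E` (loops and multiple edges allowed),
together with a real interval `[0, len e]` of positive finite length for every edge `e`.
Finiteness of the graph is imposed by `[Finite V] [Finite E]` where needed. -/
structure MetricGraph (V E : Type*) where
  src : E → V
  tgt : E → V
  len : E → ℝ
  len_pos : ∀ e, 0 < len e

namespace MetricGraph

variable {V E : Type*}

/-- The points of the metric graph: the vertices, and the interior points of the edges. -/
inductive Point (Γ : MetricGraph V E) : Type _
  | vertex (v : V) : Point Γ
  | interior (e : E) (t : ℝ) (h0 : 0 < t) (h1 : t < Γ.len e) : Point Γ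

open Classical in
/-- The point at position `t ∈ [0, len e]` of the edge `e`; the two ends of the interval are glued
to the end vertices of `e`. -/
noncomputable def pt (Γ : MetricGraph V E) (e : E) (t : ℝ) : Γ.Point :=
  if h0 : t ≤ 0 then .vertex (Γ.src e)
  else if h1 : Γ.len e ≤ t then .vertex (Γ.tgt e)
  else .interior e t (not_le.mp h0) (not_le.mp h1)

/-- Tangent vectors of the metric graph: a position on an edge `e` together with a direction in
which one can move along `e` from that position. -/
inductive Tangent (Γ : MetricGraph V E) : Type _
  | forward (e : E) (t : ℝ) (h0 : 0 ≤ t) (h1 : t < Γ.len e) : Tangent Γ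
  | backward (e : E) (t : ℝ) (h0 : 0 < t) (h1 : t ≤ Γ.len e) : Tangent Γ

/-- The unit speed path that starts in the direction of a tangent vector. -/
noncomputable def Tangent.path {Γ : MetricGraph V E} : Γ.Tangent → ℝ → Γ.Point
  | .forward e t _ _, s => Γ.pt e (t + s)
  | .backward e t _ _, s => Γ.pt e (t - s)

/-- The base point of a tangent vector. -/
noncomputable def Tangent.base {Γ : MetricGraph V E} (η : Γ.Tangent) : Γ.Point := η.path 0

/-- The set `T_v(Γ)` of outgoing tangent vectors at `v`. -/
def tangentsAt (Γ : MetricGraph V E) (v : Γ.Point) : Set Γ.Tangent := {η | η.base = v}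

/-- `f` is continuous and piecewise linear with integer slopes: on every edge there is a finite set
`B` of breakpoints such that `f` is affine with an integer slope on each closed subinterval whose
interior avoids `B`. -/
def IsPL (Γ : MetricGraph V E) (f : Γ.Point → ℝ) : Prop :=
  ∀ e : E, ∃ B : Finset ℝ, ∀ a b : ℝ, 0 ≤ a → a < b → b ≤ Γ.len e →
    (∀ t ∈ Set.Ioo a b, t ∉ B) →
    ∃ m : ℤ, ∀ t ∈ Set.Icc a b, f (Γ.pt e t) = f (Γ.pt e a) + m * (t - a)

/-- `m` is the outgoing slope of `f` along `η`. -/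
def IsSlope {Γ : MetricGraph V E} (f : Γ.Point → ℝ) (η : Γ.Tangent) (m : ℤ) : Prop :=
  ∀ᶠ s in 𝓝[>] (0 : ℝ), f (η.path s) = f η.base + m * s

open Classical in
/-- The outgoing slope `sl_η(f)`. For piecewise linear `f` it exists and is unique, see
`IsPL.exists_isSlope` and `IsSlope.slope_eq`. -/
noncomputable def slope {Γ : MetricGraph V E} (f : Γ.Point → ℝ) (η : Γ.Tangent) : ℤ :=
  if h : ∃ m : ℤ, IsSlope f η m then h.choose else 0

theorem IsSlope.unique {Γ : MetricGraph V E} {f : Γ.Point → ℝ} {η : Γ.Tangent} {m n : ℤ}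
    (hm : IsSlope f η m) (hn : IsSlope f η n) : m = n := by
  obtain ⟨s, ⟨h1, h2⟩, hs⟩ := ((hm.and hn).and self_mem_nhdsWithin).exists
  have hs' : (0 : ℝ) < s := hs
  have : (m : ℝ) * s = n * s := by linarith
  exact_mod_cast mul_right_cancel₀ hs'.ne' this

theorem IsSlope.slope_eq {Γ : MetricGraph V E} {f : Γ.Point → ℝ} {η : Γ.Tangent} {m : ℤ}
    (hm : IsSlope f η m) : slope f η = m := by
  have h : ∃ m : ℤ, IsSlope f η m := ⟨m, hm⟩
  rw [slope, dif_pos h]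
  exact h.choose_spec.unique hm

theorem IsPL.exists_isSlope {Γ : MetricGraph V E} {f : Γ.Point → ℝ} (hf : Γ.IsPL f)
    (η : Γ.Tangent) : ∃ m : ℤ, IsSlope f η m := by
  have key : ∀ (B : Finset ℝ) (t : ℝ), ∀ᶠ s in 𝓝[≠] t, s ∉ B := by
    intro B t
    have h : (↑(B.erase t) : Set ℝ)ᶜ ∈ 𝓝 t :=
      (B.erase t).finite_toSet.isClosed.isOpen_compl.mem_nhds (by simp)
    filter_upwards [nhdsWithin_le_nhds h, self_mem_nhdsWithin] with s hs hst hsB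
    exact hs (Finset.mem_coe.2 (Finset.mem_erase.2 ⟨hst, hsB⟩))
  cases η with
  | forward e t h0 h1 =>
    obtain ⟨B, hB⟩ := hf e
    have h2 : ∀ᶠ s in 𝓝[>] t, s ∉ B :=
      (key B t).filter_mono (nhdsWithin_mono _ fun x hx => ne_of_gt hx)
    obtain ⟨u, hu, hu'⟩ := (mem_nhdsGT_iff_exists_Ioo_subset' h1).1 h2
    have hu0 : t < u := hu
    obtain ⟨m, hm⟩ := hB t (min u (Γ.len e)) h0 (lt_min hu0 h1) (min_le_right _ _)
      (fun s hs => hu' ⟨hs.1, hs.2.trans_le (min_le_left _ _)⟩)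
    refine ⟨m, ?_⟩
    have hpos : 0 < min u (Γ.len e) - t := sub_pos.2 (lt_min hu0 h1)
    filter_upwards [Ioo_mem_nhdsGT hpos] with s hs
    have := hm (t + s) ⟨by linarith [hs.1], by linarith [hs.2]⟩
    simpa [Tangent.base, Tangent.path] using this
  | backward e t h0 h1 =>
    obtain ⟨B, hB⟩ := hf e
    have h2 : ∀ᶠ s in 𝓝[<] t, s ∉ B :=
      (key B t).filter_mono (nhdsWithin_mono _ fun x hx => ne_of_lt hx)
    obtain ⟨u, hu, hu'⟩ := (mem_nhdsLT_iff_exists_Ioo_subset' h0).1 h2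
    have hu0 : u < t := hu
    have hlt : max u 0 < t := max_lt hu0 h0
    obtain ⟨m, hm⟩ := hB (max u 0) t (le_max_right _ _) hlt h1
      (fun s hs => hu' ⟨(le_max_left _ _).trans_lt hs.1, hs.2⟩)
    refine ⟨-m, ?_⟩
    filter_upwards [Ioo_mem_nhdsGT (sub_pos.2 hlt)] with s hs
    have e1 := hm (t - s) ⟨by linarith [hs.2], by linarith [hs.1]⟩
    have e2 := hm t ⟨hlt.le, le_rfl⟩
    simp only [Tangent.base, Tangent.path, sub_zero]
    push_cast
    linarith

/-- Every point of a finite metric graph has only finitely many tangent vectors, so the sum in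
`ord` below is a finite sum. -/
theorem finite_tangentsAt [Finite E] (Γ : MetricGraph V E) (v : Γ.Point) :
    (Γ.tangentsAt v).Finite := by
  let pos : Γ.Point → E → ℝ := fun p e => match p with
    | .vertex _ => 0
    | .interior _ t _ _ => t
  let pos' : Γ.Point → E → ℝ := fun p e => match p with
    | .vertex _ => Γ.len e
    | .interior _ t _ _ => t
  let g : Γ.Tangent → E × Bool := fun η => match η with
    | .forward e _ _ _ => (e, true)
    | .backward e _ _ _ => (e, false)
  have hf : ∀ e t h0 h1, pos (Tangent.base (Γ := Γ) (.forward e t h0 h1)) e = t := by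
    intro e t h0 h1
    simp only [Tangent.base, Tangent.path, add_zero, pt, pos]
    by_cases h : t ≤ 0
    · simp [le_antisymm h h0]
    · simp [h, not_le.2 h1]
  have hb : ∀ e t h0 h1, pos' (Tangent.base (Γ := Γ) (.backward e t h0 h1)) e = t := by
    intro e t h0 h1
    simp only [Tangent.base, Tangent.path, sub_zero, pt, pos']
    by_cases h : Γ.len e ≤ t
    · simp [not_le.2 h0, le_antisymm h h1]
    · simp [h, not_le.2 h0]
  refine Set.Finite.of_finite_image (f := g) (Set.toFinite _) ?_
  intro η hη ξ hξ h
  have hbase : η.base = ξ.base := Eq.trans hη (Eq.symm hξ)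
  cases η with
  | forward e t h0 h1 =>
    cases ξ with
    | forward e' t' h0' h1' =>
      obtain rfl : e = e' := congrArg Prod.fst h
      obtain rfl : t = t' := by rw [← hf e t h0 h1, hbase, hf]
      rfl
    | backward e' t' h0' h1' => exact absurd (congrArg Prod.snd h) (by simp [g])
  | backward e t h0 h1 =>
    cases ξ with
    | forward e' t' h0' h1' => exact absurd (congrArg Prod.snd h) (by simp [g])
    | backward e' t' h0' h1' =>
      obtain rfl : e = e' := congrArg Prod.fst h
      obtain rfl : t = t' := by rw [← hb e t h0 h1, hbase, hb]
      rfl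

/-- The order of vanishing `ord_v(f)`, that is, the coefficient of `div(f)` at `v`. -/
noncomputable def ord {Γ : MetricGraph V E} (f : Γ.Point → ℝ) (v : Γ.Point) : ℤ :=
  -∑ᶠ η : Γ.tangentsAt v, slope f η

/-- The complete linear series `R(D)`. -/
def completeLinearSeries (Γ : MetricGraph V E) (D : Γ.Point →₀ ℤ) : Set (Γ.Point → ℝ) :=
  {f | Γ.IsPL f ∧ ∀ v, 0 ≤ D v + ord f v}

/-- The set of tropical linear combinations `min {f₁ + a₁, …, fₙ + aₙ}`, `n ≥ 1`, of elements of
`S`. -/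
def tropicalSpan {X : Type*} (S : Set (X → ℝ)) : Set (X → ℝ) :=
  {θ | ∃ (T : Finset (X → ℝ)) (hT : T.Nonempty) (a : (X → ℝ) → ℝ), ↑T ⊆ S ∧
    ∀ p, θ p = T.inf' hT (fun f => f p + a f)}

/-- A set of functions is tropically dependent if real constants can be added to its elements such
that, at every point, the minimum is attained by at least two of them. -/
def TropicallyDependent {X : Type*} (S : Finset (X → ℝ)) : Prop :=
  ∃ a : (X → ℝ) → ℝ, ∀ p, ∃ f ∈ S, ∃ g ∈ S, f ≠ g ∧ f p + a f = g p + a g ∧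
    ∀ h ∈ S, f p + a f ≤ h p + a h

/-- `(D, L)` is a tropical linear series of rank `r`. -/
structure IsTropicalLinearSeries (Γ : MetricGraph V E) (D : Γ.Point →₀ ℤ) (r : ℕ)
    (L : Set (Γ.Point → ℝ)) : Prop where
  subset : L ⊆ Γ.completeLinearSeries D
  submodule : tropicalSpan L ⊆ L
  finitely_generated : ∃ S : Finset (Γ.Point → ℝ), L = tropicalSpan (↑S : Set (Γ.Point → ℝ))
  exists_div_ge : ∀ F : Γ.Point →₀ ℤ, 0 ≤ F → (F.sum fun _ n => n) = r →
    ∃ f ∈ L, ∀ v, F v ≤ ord f v + D v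
  dependent : ∀ S : Finset (Γ.Point → ℝ), ↑S ⊆ L → S.card = r + 2 → TropicallyDependent S

/-- `(D, L)` is a strongly recursive tropical linear series of rank `r`. -/
def IsStronglyRecursive (Γ : MetricGraph V E) (D : Γ.Point →₀ ℤ) (r : ℕ)
    (L : Set (Γ.Point → ℝ)) : Prop :=
  Γ.IsTropicalLinearSeries D r L ∧
  (0 < r → ∀ S : Finset (Γ.Point → ℝ), ↑S ⊆ L → S.card = r →
    ∃ L' ⊆ L, ↑S ⊆ L' ∧ IsStronglyRecursive Γ D (r - 1) L') ∧
  (∀ s₁ s₂ : ℕ, s₁ ≤ r → s₂ ≤ r → r + 2 ≤ s₁ + s₂ →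
    ∀ S₁ S₂ : Finset (Γ.Point → ℝ), ↑S₁ ⊆ L → ↑S₂ ⊆ L → S₁.card = s₁ → S₂.card = s₂ →
    ∃ L₁ ⊆ L, ∃ L₂ ⊆ L, ↑S₁ ⊆ L₁ ∧ ↑S₂ ⊆ L₂ ∧
      IsStronglyRecursive Γ D (s₁ - 1) L₁ ∧ IsStronglyRecursive Γ D (s₂ - 1) L₂ ∧
      ∃ L₃ ⊆ L₁ ∩ L₂, IsStronglyRecursive Γ D (s₁ + s₂ - r - 2) L₃)
termination_by r
decreasing_by all_goals omega

/-- The set `sl_η(L)` of slopes along `η` of the functions in `L`. -/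
def slopes {Γ : MetricGraph V E} (L : Set (Γ.Point → ℝ)) (η : Γ.Tangent) : Set ℤ :=
  {m | ∃ f ∈ L, slope f η = m}

/-- `m = s_η[i]`: the integer `m` is the `i`-th smallest element, counted from `0`, of the set
`sl_η(L)` of slopes. -/
def IsNthSlope {Γ : MetricGraph V E} (L : Set (Γ.Point → ℝ)) (η : Γ.Tangent) (i : ℕ) (m : ℤ) :
    Prop :=
  m ∈ slopes L η ∧ {n ∈ slopes L η | n < m}.encard = i

/-- The local array of `L` in `[r]^d`, with respect to tangent vectors `η₁, …, η_d`. -/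
def localArray {Γ : MetricGraph V E} (L : Set (Γ.Point → ℝ)) (r : ℕ) {d : ℕ}
    (η : Fin d → Γ.Tangent) : Set (Fin d → Fin (r + 1)) :=
  {x | ∃ f ∈ L, ∀ i, IsNthSlope L (η i) (x i) (slope f (η i))}

end MetricGraph

/-- Dot arrays in `[r]^d`, where `[r] = {0, 1, …, r}`. The order on `[r]^d` is the componentwise
order. -/
abbrev DotArray (r d : ℕ) : Type := Set (Fin d → Fin (r + 1))

namespace DotArray

variable {r d : ℕ}

/-- The principal subarray `P[x]`. -/
def principal (P : DotArray r d) (x : Fin d → Fin (r + 1)) : DotArray r d :=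
  {y | y ∈ P ∧ x ≤ y}

/-- The rank of `P` along the `i`-axis. -/
noncomputable def axisRank (P : DotArray r d) (i : Fin d) : ℤ :=
  ((fun x : Fin d → Fin (r + 1) => x i) '' P).ncard - 1

/-- `P` is rankable of rank `s`. -/
def HasRank (P : DotArray r d) (s : ℤ) : Prop := ∀ i, axisRank P i = s

/-- Every principal subarray of `P` is rankable. -/
def TotallyRankable (P : DotArray r d) : Prop := ∀ x, ∃ s : ℤ, HasRank (principal P x) s

/-- `x` is redundant: it is the meet of a set of at least two dotted positions, each of which has a
coordinate in common with `x`. -/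
def Redundant (P : DotArray r d) (x : Fin d → Fin (r + 1)) : Prop :=
  ∃ H : Finset (Fin d → Fin (r + 1)), ↑H ⊆ P ∧ 2 ≤ H.card ∧ (∀ y ∈ H, ∃ i, y i = x i) ∧
    IsGLB (↑H : Set (Fin d → Fin (r + 1))) x

/-- `P` is a permutation array of rank `r` and dimension `d`. -/
structure IsPermutationArray (P : DotArray r d) : Prop where
  totallyRankable : TotallyRankable P
  hasRank : HasRank P r
  not_redundant : ∀ x ∈ P, ¬ Redundant P x

/-- The redundant closure `P ∪ R(P)`. -/
def redundantClosure (P : DotArray r d) : DotArray r d := P ∪ {x | Redundant P x}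

end DotArray

/-! The local array `A` at `v` has three properties: its rank along every axis is `r`, it is totally
rankable, and it is closed under meets. For a totally rankable array closed under meets, the
positions sharing no coordinate with a larger position form a permutation array whose redundant
closure is `A`.

Rank (`encard_slopes`): functions with distinct slopes along one tangent vector are independent, so
there are at most `r + 1` slopes. Conversely, prescribing `r` zeros close to `v` along `η` forces a
function with `r` concave breaks there, hence `r + 1` slopes.

Meets (`exists_slope_eq_min`): normalize two functions to vanish at `v` and take their minimum.

Total rankability (`ncard_image_principal_le`): suppose the positions above `x` show `n + 1` values
on axis `i`. Realize these values by `n + 1` functions and put them in a subseries of rank `n`. Any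
other member of the subseries is dependent on them. As their slopes along `η i` differ, that member
must attain the minimum at `v`, which bounds its slopes below by theirs in every direction. So the
whole subseries stays above `x`, and its `n + 1` slopes along `η j` give `n + 1` values on axis `j`.
-/

namespace DotArray

/-! ### Combinatorics of totally rankable arrays -/

variable {r d : ℕ}

/-- The positions of `A` that share no coordinate with a larger position of `A`. -/
def core (A : DotArray r d) : DotArray r d :=
  {x | x ∈ A ∧ ∀ y ∈ A, x ≤ y → (∃ i, y i = x i) → y = x}

/-- In a totally rankable array, if `x` shares a coordinate with a larger position, then it shares
each of its coordinates with a larger position. -/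
theorem TotallyRankable.exists_ge_of_exists_ge {A : DotArray r d} (hA : TotallyRankable A)
    {x y : Fin d → Fin (r + 1)} (hx : x ∈ A) (hy : y ∈ A) (hxy : x ≤ y) (hne : y ≠ x) {i : Fin d}
    (hi : y i = x i) (j : Fin d) : ∃ z ∈ A, x ≤ z ∧ z ≠ x ∧ z j = x j := by
  by_contra! H
  have hlt : x j < y j := lt_of_le_of_ne (hxy j) fun h => H y hy hxy hne h.symm
  -- Coordinate `j` is raised by one. If no larger position keeps `x j`, passing from `x` to `x'`
  -- removes only `x` itself. Axis `j` then loses the value `x j`, while axis `i` loses nothing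
  -- because `y` keeps `x i`; the two ranks cannot both stay equal.
  let x' : Fin d → Fin (r + 1) := Function.update x j ⟨x j + 1, by have := (y j).2; omega⟩
  have hx'j : ((x' j : Fin (r + 1)) : ℕ) = x j + 1 := by simp [x']
  have hxx' : x ≤ x' := by
    intro k
    by_cases hk : k = j
    · subst hk; rw [Fin.le_def, hx'j]; omega
    · simp [x', hk]
  have hmem : ∀ z ∈ A, x ≤ z → z ≠ x → x' ≤ z := by
    intro z hz hxz hzx k
    by_cases hk : k = j
    · subst hk
      have h1 := hxz k
      have h2 := H z hz hxz hzx
      rw [Fin.le_def] at h1 ⊢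
      have h3 : (z k : ℕ) ≠ x k := fun h => h2 (Fin.ext h)
      omega
    · simpa [x', hk] using hxz k
  have hsub : ∀ k, (fun z : Fin d → Fin (r + 1) => z k) '' principal A x' ⊆
      (fun z : Fin d → Fin (r + 1) => z k) '' principal A x := by
    rintro k _ ⟨z, ⟨hz, hz'⟩, rfl⟩
    exact ⟨z, ⟨hz, hxx'.trans hz'⟩, rfl⟩
  have hi' : (fun z : Fin d → Fin (r + 1) => z i) '' principal A x ⊆
      (fun z : Fin d → Fin (r + 1) => z i) '' principal A x' := by
    rintro _ ⟨z, ⟨hz, hz'⟩, rfl⟩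
    by_cases hzx : z = x
    · exact ⟨y, ⟨hy, hmem y hy hxy hne⟩, by simp [hzx, hi]⟩
    · exact ⟨z, ⟨hz, hmem z hz hz' hzx⟩, rfl⟩
  have hj' : ((fun z : Fin d → Fin (r + 1) => z j) '' principal A x').ncard <
      ((fun z : Fin d → Fin (r + 1) => z j) '' principal A x).ncard := by
    refine Set.ncard_lt_ncard ⟨hsub j, fun h => ?_⟩ (Set.toFinite _)
    obtain ⟨z, ⟨_, hz⟩, hzj⟩ := h ⟨x, ⟨hx, le_rfl⟩, rfl⟩
    have h1 := hz j
    rw [Fin.le_def, hx'j] at h1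
    have h2 : (z j : ℕ) = x j := congrArg Fin.val hzj
    omega
  obtain ⟨s, hs⟩ := hA x
  obtain ⟨s', hs'⟩ := hA x'
  have e1 := hs i
  have e2 := hs j
  have e3 := hs' i
  have e4 := hs' j
  have e5 := (hsub i).antisymm hi'
  simp only [axisRank] at e1 e2 e3 e4
  rw [e5] at e3
  omega

/-- Climb inside `A` keeping coordinate `i`: outside the core a larger position with the same `i`-th
coordinate always exists, and `[r]^d` is finite. -/
theorem TotallyRankable.exists_core_ge {A : DotArray r d} (hA : TotallyRankable A)
    {x : Fin d → Fin (r + 1)} (hx : x ∈ A) (i : Fin d) : ∃ y ∈ core A, x ≤ y ∧ y i = x i := by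
  induction x using (wellFounded_gt (α := Fin d → Fin (r + 1))).induction with
  | _ x ih =>
    by_cases hc : x ∈ core A
    · exact ⟨x, hc, le_rfl, rfl⟩
    · simp only [core, Set.mem_ofPred_eq, not_and, not_forall] at hc
      obtain ⟨y, hy, hxy, ⟨k, hk⟩, hne⟩ := hc hx
      obtain ⟨z, hz, hxz, hzx, hzi⟩ := hA.exists_ge_of_exists_ge hx hy hxy hne hk i
      obtain ⟨w, hw, hzw, hwi⟩ := ih z (lt_of_le_of_ne hxz hzx.symm) hz
      exact ⟨w, hw, hxz.trans hzw, hwi.trans hzi⟩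

theorem TotallyRankable.axisRank_principal_core {A : DotArray r d} (hA : TotallyRankable A)
    (x : Fin d → Fin (r + 1)) (i : Fin d) :
    axisRank (principal (core A) x) i = axisRank (principal A x) i := by
  unfold axisRank
  congr 3
  apply Set.Subset.antisymm
  · rintro _ ⟨y, ⟨hy, hxy⟩, rfl⟩
    exact ⟨y, ⟨hy.1, hxy⟩, rfl⟩
  · rintro _ ⟨y, ⟨hy, hxy⟩, rfl⟩
    obtain ⟨z, hz, hyz, hzi⟩ := hA.exists_core_ge hy i
    exact ⟨z, ⟨hz, hxy.trans hyz⟩, hzi⟩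

theorem principal_zero (A : DotArray r d) : principal A 0 = A := by
  ext x
  simp only [principal, Set.mem_ofPred_eq, and_iff_left_iff_imp]
  exact fun _ i => Fin.zero_le _

theorem TotallyRankable.isPermutationArray_core {A : DotArray r d} (hA : TotallyRankable A)
    (hr : HasRank A r) : IsPermutationArray (core A) where
  totallyRankable x := by
    obtain ⟨s, hs⟩ := hA x
    exact ⟨s, fun i => (hA.axisRank_principal_core x i).trans (hs i)⟩
  hasRank i := by
    have := hA.axisRank_principal_core 0 i
    rw [principal_zero, principal_zero] at this
    exact this.trans (hr i)
  not_redundant := by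
    rintro x hx ⟨H, hH, hcard, hshare, hglb⟩
    obtain ⟨y, hy, hyx⟩ := Finset.exists_mem_ne (by omega : 1 < H.card) x
    exact hyx (hx.2 y (hH hy).1 (hglb.1 hy) (hshare y hy))

/-- A totally rankable array that is closed under meets is the redundant closure of its core. -/
theorem TotallyRankable.redundantClosure_core {A : DotArray r d} (hA : TotallyRankable A)
    (hinf : ∀ x ∈ A, ∀ y ∈ A, x ⊓ y ∈ A) : redundantClosure (core A) = A := by
  classical
  apply Set.Subset.antisymm
  · rintro x (hx | ⟨H, hH, hcard, -, hglb⟩)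
    · exact hx.1
    · have hne : H.Nonempty := Finset.card_pos.1 (by omega)
      have h1 : H.inf' hne id ∈ A :=
        Finset.inf'_mem A hinf H hne id fun y hy => (hH hy).1
      have h2 : IsGLB (↑H : Set (Fin d → Fin (r + 1))) (H.inf' hne id) :=
        ⟨fun y hy => Finset.inf'_le id hy, fun z hz => Finset.le_inf' _ _ fun y hy => hz hy⟩
      rwa [hglb.unique h2]
  · intro x hx
    by_cases hc : x ∈ core A
    · exact Or.inl hc
    · right
      choose p hp hxp hpi using fun i => hA.exists_core_ge hx i
      have hpx : ∀ i, p i ≠ x := fun i h => hc (h ▸ hp i)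
      simp only [core, Set.mem_ofPred_eq, not_and, not_forall] at hc
      obtain ⟨y, -, -, ⟨k, -⟩, -⟩ := hc hx
      refine ⟨Finset.univ.image p, ?_, ?_, ?_, ?_⟩
      · intro z hz
        obtain ⟨i, -, rfl⟩ := Finset.mem_image.1 (Finset.mem_coe.1 hz)
        exact hp i
      -- If all `p i` coincided, the common position would agree with `x` in every coordinate.
      · by_contra! hlt
        have hle : (Finset.univ.image p).card ≤ 1 := by omega
        refine hpx k (funext fun i => ?_)
        rw [Finset.card_le_one.1 hle (p k) (Finset.mem_image_of_mem _ (Finset.mem_univ _)) (p i)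
          (Finset.mem_image_of_mem _ (Finset.mem_univ _)), hpi]
      · intro z hz
        obtain ⟨i, -, rfl⟩ := Finset.mem_image.1 hz
        exact ⟨i, hpi i⟩
      · constructor
        · intro z hz
          obtain ⟨i, -, rfl⟩ := Finset.mem_image.1 (Finset.mem_coe.1 hz)
          exact hxp i
        · intro z hz i
          rw [← hpi i]
          exact hz (Finset.mem_coe.2 (Finset.mem_image_of_mem _ (Finset.mem_univ i))) i

end DotArray

/-! ### Ranking the slopes -/

/-- A set of `r + 1` integers is indexed in increasing order by `[r]`. -/
theorem exists_strictMonoOn_index {r : ℕ} {s : Set ℤ} (h : s.encard = r + 1) :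
    ∃ φ : ℤ → Fin (r + 1), StrictMonoOn φ s ∧
      ∀ m ∈ s, ∀ k : Fin (r + 1), {n ∈ s | n < m}.encard = ((k : ℕ) : ℕ∞) ↔ φ m = k := by
  have hfin : s.Finite := Set.finite_of_encard_eq_coe (k := r + 1) (by simpa using h)
  have hcard : s.ncard = r + 1 := by
    have := hfin.cast_ncard_eq
    rw [h] at this
    exact_mod_cast this
  have hsub : ∀ m, {n ∈ s | n < m}.Finite := fun m => hfin.subset fun n hn => hn.1
  have hlt : ∀ m ∈ s, {n ∈ s | n < m}.ncard < r + 1 := by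
    intro m hm
    rw [← hcard]
    exact Set.ncard_lt_ncard ⟨fun n hn => hn.1, fun h' => lt_irrefl _ (h' hm).2⟩ hfin
  -- The truncation by `r` only makes the map total; it has no effect on `s`.
  refine ⟨fun m => ⟨min r {n ∈ s | n < m}.ncard, by omega⟩, ?_, ?_⟩
  · intro a ha b hb hab
    have h1 := hlt a ha
    have h2 := hlt b hb
    have h3 : {n ∈ s | n < a}.ncard < {n ∈ s | n < b}.ncard :=
      Set.ncard_lt_ncard ⟨fun n hn => ⟨hn.1, hn.2.trans hab⟩,
        fun h' => lt_irrefl _ (h' ⟨ha, hab⟩).2⟩ (hsub b)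
    simp only [Fin.mk_lt_mk]
    omega
  · intro m hm k
    have h1 := hlt m hm
    rw [← (hsub m).cast_ncard_eq, Fin.ext_iff, Nat.cast_inj]
    simp only
    omega

/-! ### Slopes at a point: dependences and minima -/

namespace MetricGraph

variable {V E : Type*} {Γ : MetricGraph V E}

/-- Affine functions compare near `0` as their lexicographically ordered coefficients do. -/
theorem IsSlope.eventually_lex {f g : Γ.Point → ℝ} {η : Γ.Tangent} {m n : ℤ}
    (hf : IsSlope f η m) (hg : IsSlope g η n) (a b : ℝ) :
    ∀ᶠ s in 𝓝[>] (0 : ℝ), f (η.path s) + a ≤ g (η.path s) + b →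
      f η.base + a ≤ g η.base + b ∧ (f η.base + a = g η.base + b → m ≤ n) := by
  by_cases hlt : g η.base + b < f η.base + a
  · have hcont : Tendsto (fun s : ℝ => f η.base + m * s + a - (g η.base + n * s + b)) (𝓝[>] 0)
        (𝓝 (f η.base + m * 0 + a - (g η.base + n * 0 + b))) :=
      (Continuous.tendsto (by fun_prop) _).mono_left nhdsWithin_le_nhds
    filter_upwards [hf, hg, hcont.eventually_const_lt (u := 0) (by linarith)] with s h1 h2 h3 h4
    rw [h1, h2] at h4
    linarith
  · filter_upwards [hf, hg, self_mem_nhdsWithin] with s h1 h2 h3 h4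
    refine ⟨not_lt.1 hlt, fun h => ?_⟩
    rw [h1, h2] at h4
    have hs : (0 : ℝ) < s := h3
    have : (m : ℝ) * s ≤ n * s := by linarith
    exact_mod_cast le_of_mul_le_mul_right this hs

/-- In a tropical dependence, at the base of each tangent vector at least two functions attain the
minimum and have minimal slope among those which do. -/
theorem exists_pair_of_dependent {S : Finset (Γ.Point → ℝ)} {a : (Γ.Point → ℝ) → ℝ}
    (ha : ∀ p, ∃ f ∈ S, ∃ g ∈ S, f ≠ g ∧ f p + a f = g p + a g ∧ ∀ h ∈ S, f p + a f ≤ h p + a h)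
    (hS : ∀ f ∈ S, Γ.IsPL f) (η : Γ.Tangent) :
    ∃ f ∈ S, ∃ g ∈ S, f ≠ g ∧ f η.base + a f = g η.base + a g ∧ slope f η = slope g η ∧
      ∀ h ∈ S, f η.base + a f ≤ h η.base + a h ∧
        (f η.base + a f = h η.base + a h → slope f η ≤ slope h η) := by
  have hsl : ∀ f ∈ S, IsSlope f η (slope f η) := fun f hf => by
    obtain ⟨m, hm⟩ := (hS f hf).exists_isSlope η
    rwa [hm.slope_eq]
  have hev : ∀ᶠ s in 𝓝[>] (0 : ℝ), ∀ f ∈ S, ∀ g ∈ S,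
      f (η.path s) + a f ≤ g (η.path s) + a g →
      f η.base + a f ≤ g η.base + a g ∧
        (f η.base + a f = g η.base + a g → slope f η ≤ slope g η) := by
    rw [Filter.eventually_all_finset]
    intro f hf
    rw [Filter.eventually_all_finset]
    intro g hg
    exact (hsl f hf).eventually_lex (hsl g hg) _ _
  -- The dependence is read off at one point so close to the base that every comparison there is
  -- lexicographic in value and slope at the base.
  obtain ⟨s, hs⟩ := hev.exists
  obtain ⟨f, hf, g, hg, hne, heq, hle⟩ := ha (η.path s)
  have h1 := hs f hf g hg heq.le
  have h2 := hs g hg f hf heq.ge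
  have h3 := h1.1.antisymm h2.1
  exact ⟨f, hf, g, hg, hne, h3, (h1.2 h3).antisymm (h2.2 h3.symm),
    fun h hh => hs f hf h hh (hle h hh)⟩

theorem not_tropicallyDependent_of_injOn_slope {S : Finset (Γ.Point → ℝ)}
    (hS : ∀ f ∈ S, Γ.IsPL f) {η : Γ.Tangent} (hinj : Set.InjOn (fun f => slope f η) S) :
    ¬ TropicallyDependent S := by
  rintro ⟨a, ha⟩
  obtain ⟨f, hf, g, hg, hne, -, h, -⟩ := exists_pair_of_dependent ha hS η
  exact hne (hinj hf hg h)

/-- If the functions in `S` have distinct slopes along some tangent vector at `v` and `insert g S`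
is dependent, then along each tangent vector at `v` the slope of `g` is at least that of some
function in `S`. -/
theorem exists_slope_le_of_dependent [DecidableEq (Γ.Point → ℝ)] {S : Finset (Γ.Point → ℝ)}
    {g : Γ.Point → ℝ} (hPL : ∀ f ∈ insert g S, Γ.IsPL f) {η : Γ.Tangent}
    (hinj : Set.InjOn (fun f => slope f η) S) (hdep : TropicallyDependent (insert g S))
    {ξ : Γ.Tangent} (hξ : ξ.base = η.base) : ∃ f ∈ S, slope f ξ ≤ slope g ξ := by
  obtain ⟨a, ha⟩ := hdep
  -- Along `η` the minimum is tied by two functions of equal slope; by injectivity they are not both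
  -- in `S`, so one of them is `g`.
  have hmin : ∀ h ∈ insert g S, g η.base + a g ≤ h η.base + a h := by
    obtain ⟨f, hf, f', hf', hne, heq, hsl, hle⟩ := exists_pair_of_dependent ha hPL η
    intro h hh
    rcases Finset.mem_insert.1 hf with rfl | hfS
    · exact (hle h hh).1
    · rcases Finset.mem_insert.1 hf' with rfl | hfS'
      · rw [← heq]; exact (hle h hh).1
      · exact absurd (hinj hfS hfS' hsl) hne
  have key : ∀ f ∈ insert g S, (∀ h ∈ insert g S, f ξ.base + a f ≤ h ξ.base + a h ∧
      (f ξ.base + a f = h ξ.base + a h → slope f ξ ≤ slope h ξ)) → slope f ξ ≤ slope g ξ := by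
    intro f hf hle
    have h1 := hle g (Finset.mem_insert_self _ _)
    refine h1.2 (h1.1.antisymm ?_)
    rw [hξ]
    exact hmin f hf
  obtain ⟨f, hf, f', hf', hne, heq, hsl, hle⟩ := exists_pair_of_dependent ha hPL ξ
  rcases Finset.mem_insert.1 hf with rfl | hfS
  · rcases Finset.mem_insert.1 hf' with rfl | hfS'
    · exact absurd rfl hne
    · exact ⟨f', hfS', hsl.ge⟩
  · exact ⟨f, hfS, key f hf hle⟩

/-- At each point, a minimum of functions has the slope of one of the functions that attain it. -/
theorem exists_slope_eq_of_inf' {T : Finset (Γ.Point → ℝ)} (hT : T.Nonempty)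
    {a : (Γ.Point → ℝ) → ℝ} {θ : Γ.Point → ℝ} (hθ : ∀ p, θ p = T.inf' hT fun f => f p + a f)
    {η : Γ.Tangent} {m : ℤ} (hm : IsSlope θ η m) {σ : (Γ.Point → ℝ) → ℤ}
    (hσ : ∀ f ∈ T, IsSlope f η (σ f)) :
    ∃ f ∈ T, θ η.base = f η.base + a f ∧ m = σ f := by
  have hev : ∀ᶠ s in 𝓝[>] (0 : ℝ), ∀ f ∈ T,
      (θ (η.path s) + 0 ≤ f (η.path s) + a f →
        θ η.base + 0 ≤ f η.base + a f ∧ (θ η.base + 0 = f η.base + a f → m ≤ σ f)) ∧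
      (f (η.path s) + a f ≤ θ (η.path s) + 0 →
        f η.base + a f ≤ θ η.base + 0 ∧ (f η.base + a f = θ η.base + 0 → σ f ≤ m)) := by
    rw [Filter.eventually_all_finset]
    intro f hf
    exact (hm.eventually_lex (hσ f hf) _ _).and ((hσ f hf).eventually_lex hm _ _)
  obtain ⟨s, hs⟩ := hev.exists
  obtain ⟨f, hf, hfs⟩ := Finset.exists_mem_eq_inf' hT fun f => f (η.path s) + a f
  rw [← hθ] at hfs
  have h1 := (hs f hf).1 (by linarith)
  have h2 := (hs f hf).2 (by linarith)
  have h3 := h1.1.antisymm h2.1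
  exact ⟨f, hf, by linarith, (h1.2 h3).antisymm (h2.2 h3.symm)⟩

/-! ### Interior points of edges -/

theorem tangentsAt_interior (e : E) (t : ℝ) (h0 : 0 < t) (h1 : t < Γ.len e) :
    Γ.tangentsAt (.interior e t h0 h1) = {.forward e t h0.le h1, .backward e t h0 h1.le} := by
  ext η
  simp only [tangentsAt, Set.mem_ofPred_eq, Set.mem_insert_iff, Set.mem_singleton_iff,
    Tangent.base]
  constructor
  · intro h
    cases η with
    | forward e' t' h0' h1' =>
      simp only [Tangent.path, pt, add_zero] at h
      split_ifs at h
      cases h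
      exact Or.inl rfl
    | backward e' t' h0' h1' =>
      simp only [Tangent.path, pt, sub_zero] at h
      split_ifs at h
      cases h
      exact Or.inr rfl
  · rintro (rfl | rfl) <;> simp [Tangent.path, pt, not_le.2 h0, not_le.2 h1]

theorem ord_interior (f : Γ.Point → ℝ) (e : E) (t : ℝ) (h0 : 0 < t) (h1 : t < Γ.len e) :
    ord f (.interior e t h0 h1) =
      -(slope f (.forward e t h0.le h1) + slope f (.backward e t h0 h1.le)) := by
  unfold ord
  rw [finsum_set_coe_eq_finsum_mem (f := fun η => slope f η), tangentsAt_interior,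
    finsum_mem_pair (by simp)]

/-- The path of a tangent vector runs through interior points of an edge for a short time. -/
theorem Tangent.exists_path_interior (η : Γ.Tangent) : ∃ δ > 0, Set.InjOn η.path (Set.Ioo 0 δ) ∧
    ∀ s ∈ Set.Ioo 0 δ, ∃ τ₁ τ₂ : Γ.Tangent, (∀ u, τ₁.path u = η.path (s + u)) ∧
      (∀ u, τ₂.path u = η.path (s - u)) ∧
      ∀ f, ord f (η.path s) = -(slope f τ₁ + slope f τ₂) := by
  cases η with
  | forward e t h0 h1 =>
    have hpath : ∀ s, (hs : s ∈ Set.Ioo 0 (Γ.len e - t)) →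
        Tangent.path (Γ := Γ) (.forward e t h0 h1) s =
          .interior e (t + s) (by linarith [hs.1]) (by linarith [hs.2]) := by
      intro s hs
      have h2 : 0 < t + s := by linarith [hs.1]
      have h3 : t + s < Γ.len e := by linarith [hs.2]
      rw [Tangent.path, pt, dif_neg (not_le.2 h2), dif_neg (not_le.2 h3)]
    refine ⟨Γ.len e - t, sub_pos.2 h1, ?_, ?_⟩
    · intro s hs s' hs' h
      rw [hpath s hs, hpath s' hs'] at h
      injection h with _ h
      linarith
    · intro s hs
      refine ⟨.forward e (t + s) (by linarith [hs.1]) (by linarith [hs.2]),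
        .backward e (t + s) (by linarith [hs.1]) (by linarith [hs.2]), ?_, ?_, ?_⟩
      · intro u; simp only [Tangent.path]; ring_nf
      · intro u; simp only [Tangent.path]; ring_nf
      · intro f
        rw [hpath s hs, ord_interior]
  | backward e t h0 h1 =>
    have hpath : ∀ s, (hs : s ∈ Set.Ioo 0 t) →
        Tangent.path (Γ := Γ) (.backward e t h0 h1) s =
          .interior e (t - s) (by linarith [hs.2]) (by linarith [hs.1]) := by
      intro s hs
      have h2 : 0 < t - s := by linarith [hs.2]
      have h3 : t - s < Γ.len e := by linarith [hs.1]
      rw [Tangent.path, pt, dif_neg (not_le.2 h2), dif_neg (not_le.2 h3)]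
    refine ⟨t, h0, ?_, ?_⟩
    · intro s hs s' hs' h
      rw [hpath s hs, hpath s' hs'] at h
      injection h with _ h
      linarith
    · intro s hs
      refine ⟨.backward e (t - s) (by linarith [hs.2]) (by linarith [hs.1]),
        .forward e (t - s) (by linarith [hs.2]) (by linarith [hs.1]), ?_, ?_, ?_⟩
      · intro u; simp only [Tangent.path]; ring_nf
      · intro u; simp only [Tangent.path]; ring_nf
      · intro f
        rw [hpath s hs, ord_interior, add_comm]

theorem subset_tropicalSpan {X : Type*} (S : Set (X → ℝ)) : S ⊆ tropicalSpan S :=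
  fun f hf => ⟨{f}, Finset.singleton_nonempty f, 0, by simpa using hf, by simp⟩

/-! ### Slopes in a tropical linear series -/

namespace IsTropicalLinearSeries

variable {D : Γ.Point →₀ ℤ} {r : ℕ} {L : Set (Γ.Point → ℝ)}

theorem isPL (hL : Γ.IsTropicalLinearSeries D r L) {f : Γ.Point → ℝ} (hf : f ∈ L) : Γ.IsPL f :=
  (hL.subset hf).1

theorem isSlope (hL : Γ.IsTropicalLinearSeries D r L) {f : Γ.Point → ℝ} (hf : f ∈ L)
    (η : Γ.Tangent) : IsSlope f η (slope f η) := by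
  obtain ⟨m, hm⟩ := (hL.isPL hf).exists_isSlope η
  rwa [hm.slope_eq]

theorem nonempty (hL : Γ.IsTropicalLinearSeries D r L) (v : Γ.Point) : L.Nonempty := by
  obtain ⟨f, hf, -⟩ := hL.exists_div_ge (Finsupp.single v (r : ℤ))
    (Finsupp.single_nonneg.2 (by positivity)) (Finsupp.sum_single_index rfl)
  exact ⟨f, hf⟩

/-- Adding constants gives infinitely many members, so finite sets of functions can be padded to any
larger size. -/
theorem infinite (hL : Γ.IsTropicalLinearSeries D r L) (v : Γ.Point) : L.Infinite := by
  obtain ⟨f, hf⟩ := hL.nonempty v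
  refine Set.infinite_of_injective_forall_mem (f := fun (c : ℝ) p => f p + c)
    (fun c c' h => add_left_cancel (congrFun h v)) fun c => hL.submodule ?_
  exact ⟨{f}, Finset.singleton_nonempty f, fun _ => c, by simpa using hf, by simp⟩

theorem encard_slopes_le (hL : Γ.IsTropicalLinearSeries D r L) (η : Γ.Tangent) :
    (slopes L η).encard ≤ r + 1 := by
  classical
  by_contra! hlt
  obtain ⟨t, ht, htc⟩ := Set.exists_subset_encard_eq (k := (r + 2 : ℕ)) (s := slopes L η) (by
    have := Order.add_one_le_of_lt hlt
    push_cast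
    rwa [add_assoc, one_add_one_eq_two] at this)
  have hfin := Set.finite_of_encard_eq_coe htc
  lift t to Finset ℤ using hfin
  rw [Set.encard_coe_eq_coe_finsetCard, Nat.cast_inj] at htc
  choose! F hF hFs using fun m (hm : m ∈ slopes L η) => hm
  have hcard : (t.image F).card = r + 2 := by
    rw [Finset.card_image_of_injOn, htc]
    intro m hm n hn h
    rw [← hFs m (ht hm), ← hFs n (ht hn), h]
  have hmem : ∀ f ∈ t.image F, f ∈ L := by
    intro f hf
    obtain ⟨m, hm, rfl⟩ := Finset.mem_image.1 hf
    exact hF m (ht hm)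
  refine not_tropicallyDependent_of_injOn_slope (fun f hf => hL.isPL (hmem f hf)) (η := η) ?_
    (hL.dependent (t.image F) (fun f hf => hmem f hf) hcard)
  intro f hf g hg h
  obtain ⟨m, hm, rfl⟩ := Finset.mem_image.1 (Finset.mem_coe.1 hf)
  obtain ⟨n, hn, rfl⟩ := Finset.mem_image.1 (Finset.mem_coe.1 hg)
  have h' : slope (F m) η = slope (F n) η := h
  rw [hFs m (ht hm), hFs n (ht hn)] at h'
  rw [h']

/-- A function with zeros at `r` points close to the base is there a minimum of affine generators,
hence concave, with a break at each point. The pieces between breaks have `r + 1` different slopes,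
all of them slopes of generators. -/
theorem le_encard_slopes (hL : Γ.IsTropicalLinearSeries D r L) (η : Γ.Tangent) :
    (r + 1 : ℕ∞) ≤ (slopes L η).encard := by
  obtain ⟨δ, hδ, hinj, hpath⟩ := η.exists_path_interior
  obtain ⟨S, hS⟩ := hL.finitely_generated
  have hSL : ∀ f ∈ S, f ∈ L := fun f hf => by rw [hS]; exact subset_tropicalSpan _ hf
  -- an interval on which the generators are affine and `D` vanishes
  have hD : ∀ᶠ s in 𝓝[>] (0 : ℝ), s ∈ Set.Ioo 0 δ ∧ η.path s ∉ D.support := by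
    have hfin : (Set.Ioo 0 δ ∩ η.path ⁻¹' (D.support : Set Γ.Point)).Finite :=
      Set.Finite.of_finite_image (f := η.path)
        (D.support.finite_toSet.subset (by rintro _ ⟨s, hs, rfl⟩; exact hs.2))
        (hinj.mono Set.inter_subset_left)
    have h0 : (Set.Ioo 0 δ ∩ η.path ⁻¹' (D.support : Set Γ.Point))ᶜ ∈ 𝓝 (0 : ℝ) :=
      hfin.isClosed.isOpen_compl.mem_nhds (by simp)
    filter_upwards [Ioo_mem_nhdsGT hδ, nhdsWithin_le_nhds h0] with s hs hs'
    exact ⟨hs, fun h => hs' ⟨hs, h⟩⟩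
  have hlin : ∀ᶠ s in 𝓝[>] (0 : ℝ), ∀ f ∈ S,
      f (η.path s) = f η.base + slope f η * s := by
    rw [Filter.eventually_all_finset]
    exact fun f hf => hL.isSlope (hSL f hf) η
  obtain ⟨ε, hε, hsub⟩ := mem_nhdsGT_iff_exists_Ioo_subset.1 (hD.and hlin)
  have hε0 : (0 : ℝ) < ε := hε
  -- These are `r` equally spaced points inside the interval.
  let p : Fin r → ℝ := fun k => ε * ((k + 1 : ℝ) / (r + 1))
  have hp : ∀ k, p k ∈ Set.Ioo 0 ε := by
    intro k
    have hk : (k : ℝ) < r := by exact_mod_cast k.2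
    have h1 : (0 : ℝ) < r + 1 := by positivity
    refine ⟨by positivity, ?_⟩
    have : ((k : ℝ) + 1) / (r + 1) < 1 := (div_lt_one h1).2 (by linarith)
    calc p k < ε * 1 := mul_lt_mul_of_pos_left this hε0
      _ = ε := mul_one _
  have hpmono : StrictMono p := by
    intro k l hkl
    have hkl' : (k : ℝ) < l := by exact_mod_cast hkl
    have h1 : (0 : ℝ) < r + 1 := by positivity
    exact mul_lt_mul_of_pos_left (div_lt_div_of_pos_right (by linarith) h1) hε0
  obtain ⟨θ, hθL, hθ⟩ := hL.exists_div_ge (∑ k, Finsupp.single (η.path (p k)) 1)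
    (Finset.sum_nonneg fun k _ => Finsupp.single_nonneg.2 zero_le_one) (by
      rw [← Finsupp.sum_finsetSum_index (fun _ => rfl) fun _ _ _ => rfl]
      simp [Finsupp.sum_single_index])
  have hord : ∀ k, 1 ≤ ord θ (η.path (p k)) := by
    intro k
    have h1 := hθ (η.path (p k))
    rw [Finsupp.notMem_support_iff.1 (hsub (hp k)).1.2, add_zero, Finsupp.finsetSum_apply] at h1
    refine le_trans ?_ h1
    refine le_trans ?_ (Finset.single_le_sum (f := fun l =>
      (Finsupp.single (η.path (p l)) (1 : ℤ)) (η.path (p k))) (fun l _ =>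
        Finsupp.single_nonneg.2 zero_le_one _) (Finset.mem_univ k))
    simp
  have hθS := hθL
  rw [hS] at hθS
  obtain ⟨T, hT, a, hTS, hinf⟩ := hθS
  -- Here `f` carries `θ` just after `p k` and `g` just before it; the order at `p k` is the drop in
  -- slope, `slope g η - slope f η`, which is at least `1`.
  have hbreak : ∀ k, ∃ f ∈ T, ∃ g ∈ T, θ (η.path (p k)) = f (η.path (p k)) + a f ∧
      θ (η.path (p k)) = g (η.path (p k)) + a g ∧ slope f η < slope g η := by
    intro k
    obtain ⟨τ₁, τ₂, h1, h2, h3⟩ := hpath (p k) (hsub (hp k)).1.1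
    have hb1 : τ₁.base = η.path (p k) := by rw [Tangent.base, h1, add_zero]
    have hb2 : τ₂.base = η.path (p k) := by rw [Tangent.base, h2, sub_zero]
    have hσ1 : ∀ f ∈ T, IsSlope f τ₁ (slope f η) := by
      intro f hf
      have hpos : 0 < ε - p k := sub_pos.2 (hp k).2
      filter_upwards [Ioo_mem_nhdsGT hpos] with u hu
      rw [h1, hb1, (hsub (hp k)).2 f (hTS hf),
        (hsub ⟨by linarith [(hp k).1, hu.1], by linarith [hu.2]⟩ : _ ∧ _).2 f (hTS hf)]
      ring
    have hσ2 : ∀ f ∈ T, IsSlope f τ₂ (-slope f η) := by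
      intro f hf
      filter_upwards [Ioo_mem_nhdsGT (hp k).1] with u hu
      rw [h2, hb2, (hsub (hp k)).2 f (hTS hf),
        (hsub ⟨by linarith [hu.2], by linarith [(hp k).2, hu.1]⟩ : _ ∧ _).2 f (hTS hf)]
      push_cast
      ring
    obtain ⟨f, hf, hf1, hf2⟩ := exists_slope_eq_of_inf' hT hinf (hL.isSlope hθL τ₁) hσ1
    obtain ⟨g, hg, hg1, hg2⟩ := exists_slope_eq_of_inf' hT hinf (hL.isSlope hθL τ₂) hσ2
    rw [hb1] at hf1
    rw [hb2] at hg1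
    have h4 := hord k
    rw [h3, hf2, hg2] at h4
    exact ⟨f, hf, g, hg, hf1, hg1, by omega⟩
  choose f hf g hg hfp hgp hfg using hbreak
  have hmin : ∀ h ∈ T, ∀ q, θ q ≤ h q + a h := fun h hh q => by
    rw [hinf]; exact Finset.inf'_le (fun f => f q + a f) hh
  -- Concavity: `f k` is minimal at `p k` and `g l` at `p l`, and comparing the two at both points
  -- orders their slopes.
  have hconc : ∀ k l, k < l → slope (g l) η ≤ slope (f k) η := by
    intro k l hkl
    have hlt := hpmono hkl
    have h1 := hmin (g l) (hg l) (η.path (p k))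
    have h2 := hmin (f k) (hf k) (η.path (p l))
    rw [hfp k, (hsub (hp k)).2 _ (hTS (hf k)), (hsub (hp k)).2 _ (hTS (hg l))] at h1
    rw [hgp l, (hsub (hp l)).2 _ (hTS (hf k)), (hsub (hp l)).2 _ (hTS (hg l))] at h2
    have h3 : (slope (g l) η : ℝ) * (p l - p k) ≤ slope (f k) η * (p l - p k) := by linarith
    exact_mod_cast le_of_mul_le_mul_right h3 (sub_pos.2 hlt)
  have hslope : ∀ h ∈ T, slope h η ∈ slopes L η := fun h hh => ⟨h, hSL h (hTS hh), rfl⟩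
  have hcount : ∀ σ : Fin (r + 1) → ℤ, StrictAnti σ → (∀ k, σ k ∈ slopes L η) →
      (r + 1 : ℕ∞) ≤ (slopes L η).encard := by
    intro σ hσ hσL
    have h1 := hσ.injective.encard_range
    rw [ENat.card_eq_coe_fintype_card, Fintype.card_fin] at h1
    rw [Nat.cast_succ] at h1
    exact h1.trans (Set.encard_le_encard (Set.range_subset_iff.2 hσL))
  have hanti : StrictAnti fun k => slope (f k) η :=
    fun k l hkl => (hfg l).trans_le (hconc k l hkl)
  cases r with
  | zero =>
    obtain ⟨h, hh⟩ := hT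
    exact hcount (fun _ => slope h η) (fun k l hkl => absurd hkl (by omega)) fun _ => hslope h hh
  | succ n =>
    -- The slope before the first break is added to the `r` slopes after the breaks.
    refine hcount (Matrix.vecCons (slope (g 0) η) fun k => slope (f k) η)
      (strictAnti_vecCons.2 ⟨hfg 0, hanti⟩) fun k => ?_
    refine Fin.cases ?_ (fun k => ?_) k
    · exact hslope _ (hg 0)
    · exact hslope _ (hf k)

theorem encard_slopes (hL : Γ.IsTropicalLinearSeries D r L) (η : Γ.Tangent) :
    (slopes L η).encard = r + 1 :=
  (hL.encard_slopes_le η).antisymm (hL.le_encard_slopes η)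

/-- The slopes of two functions at a point have their minima realized by a function. -/
theorem exists_slope_eq_min (hL : Γ.IsTropicalLinearSeries D r L) {f g : Γ.Point → ℝ}
    (hf : f ∈ L) (hg : g ∈ L) (v : Γ.Point) :
    ∃ h ∈ L, ∀ η ∈ Γ.tangentsAt v, slope h η = min (slope f η) (slope g η) := by
  classical
  by_cases hfg : f = g
  · exact ⟨f, hf, fun η _ => by simp [hfg]⟩
  -- Both terms vanish at `v`, so near `v` the smaller slope wins in each direction separately.
  refine ⟨fun p => min (f p + -f v) (g p + -g v), hL.submodule ?_, ?_⟩
  · refine ⟨{f, g}, Finset.insert_nonempty _ _, fun h => -h v, ?_, fun p => ?_⟩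
    · intro h hh
      rcases Finset.mem_insert.1 (Finset.mem_coe.1 hh) with rfl | hh
      · exact hf
      · rwa [Finset.mem_singleton.1 hh]
    · rw [Finset.inf'_insert (Finset.singleton_nonempty g)]
      simp
  · intro η hη
    have hv : η.base = v := hη
    refine IsSlope.slope_eq ?_
    filter_upwards [hL.isSlope hf η, hL.isSlope hg η, self_mem_nhdsWithin] with s h1 h2 hs
    have hs' : (0 : ℝ) ≤ s := le_of_lt hs
    simp only [h1, h2, hv, Int.cast_min, min_mul_of_nonneg _ _ hs']
    ring_nf
    simp

end IsTropicalLinearSeries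

/-! ### Subseries and total rankability -/

/-- In a strongly recursive series of rank `r`, each set of at most `r + 1` functions is contained
in a strongly recursive subseries of the expected rank. -/
theorem IsStronglyRecursive.exists_subseries {D : Γ.Point →₀ ℤ} (v : Γ.Point) {r n : ℕ}
    (hn : n ≤ r) : ∀ {L : Set (Γ.Point → ℝ)}, Γ.IsStronglyRecursive D r L →
    ∀ {S : Finset (Γ.Point → ℝ)}, ↑S ⊆ L → S.card = n + 1 →
    ∃ L' ⊆ L, ↑S ⊆ L' ∧ Γ.IsStronglyRecursive D n L' := by
  induction r, hn using Nat.le_induction with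
  | base => exact fun {L} hL {S} hS _ => ⟨L, subset_rfl, hS, hL⟩
  | succ r hr ih =>
    intro L hL S hS hc
    have hL' := hL
    rw [IsStronglyRecursive] at hL'
    obtain ⟨hT, h3, -⟩ := hL'
    -- Condition 3 needs exactly as many functions as the rank, so `S` is padded.
    obtain ⟨S', hSS', hS'L, hS'c⟩ := (hT.infinite v).exists_superset_ncard_eq hS S.finite_toSet
      (k := r + 1) (by rw [Set.ncard_coe_finset]; omega)
    lift S' to Finset (Γ.Point → ℝ) using Set.finite_of_ncard_pos (by omega)
    rw [Set.ncard_coe_finset] at hS'c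
    obtain ⟨L₁, hL₁, hS₁, hR₁⟩ := h3 (Nat.succ_pos r) S' hS'L hS'c
    obtain ⟨L₂, hL₂, hS₂, hR₂⟩ := ih hR₁ (hSS'.trans hS₁) hc
    exact ⟨L₂, hL₂.trans hL₁, hS₂, hR₂⟩

theorem IsStronglyRecursive.isTropicalLinearSeries {D : Γ.Point →₀ ℤ} {r : ℕ}
    {L : Set (Γ.Point → ℝ)} (hL : Γ.IsStronglyRecursive D r L) :
    Γ.IsTropicalLinearSeries D r L := by
  rw [IsStronglyRecursive] at hL
  exact hL.1

section LocalArray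

variable {D : Γ.Point →₀ ℤ} {r : ℕ} {L : Set (Γ.Point → ℝ)} {d : ℕ} {η : Fin d → Γ.Tangent}
  {v : Γ.Point} {φ : Fin d → ℤ → Fin (r + 1)}

/-- The number of coordinates on each axis of the principal subarrays of the array of slopes does
not depend on the axis. -/
theorem IsStronglyRecursive.ncard_image_principal_le (hL : Γ.IsStronglyRecursive D r L)
    (hη : ∀ i, (η i).base = v) (hφ : ∀ i, StrictMonoOn (φ i) (slopes L (η i)))
    {A : DotArray r d} (hA : ∀ x, x ∈ A ↔ ∃ f ∈ L, ∀ i, φ i (slope f (η i)) = x i)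
    (x : Fin d → Fin (r + 1)) (i j : Fin d) :
    ((fun y : Fin d → Fin (r + 1) => y i) '' DotArray.principal A x).ncard ≤
      ((fun y : Fin d → Fin (r + 1) => y j) '' DotArray.principal A x).ncard := by
  classical
  set C := (fun y : Fin d → Fin (r + 1) => y i) '' DotArray.principal A x with hC
  rcases Nat.eq_zero_or_pos C.ncard with h0 | hpos
  · omega
  obtain ⟨n, hn⟩ : ∃ n, C.ncard = n + 1 := ⟨C.ncard - 1, by omega⟩
  have hnr : n ≤ r := by
    have := Set.ncard_le_card C
    simp at this
    omega
  have hCf : ∀ c ∈ C, ∃ f ∈ L, (∀ k, x k ≤ φ k (slope f (η k))) ∧ φ i (slope f (η i)) = c := by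
    rintro _ ⟨y, ⟨hy, hxy⟩, rfl⟩
    obtain ⟨f, hf, hfy⟩ := (hA y).1 hy
    exact ⟨f, hf, fun k => (hxy k).trans (hfy k).ge, hfy i⟩
  choose! F hFL hFx hFi using hCf
  set S := C.toFinset.image F with hS
  have hmem : ∀ f ∈ S, ∃ c ∈ C, F c = f := by
    intro f hf
    obtain ⟨c, hc, rfl⟩ := Finset.mem_image.1 hf
    exact ⟨c, Set.mem_toFinset.1 hc, rfl⟩
  have hSL : ↑S ⊆ L := by
    intro f hf
    obtain ⟨c, hc, rfl⟩ := hmem f hf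
    exact hFL c hc
  have hScard : S.card = n + 1 := by
    rw [hS, Finset.card_image_of_injOn, ← Set.ncard_eq_toFinset_card', hn]
    intro c hc c' hc' h
    rw [← hFi c (Set.mem_toFinset.1 hc), ← hFi c' (Set.mem_toFinset.1 hc'), h]
  have hinj : Set.InjOn (fun f => slope f (η i)) S := by
    intro f hf g hg h
    obtain ⟨c, hc, rfl⟩ := hmem f hf
    obtain ⟨c', hc', rfl⟩ := hmem g hg
    have h' : slope (F c) (η i) = slope (F c') (η i) := h
    rw [← hFi c hc, ← hFi c' hc', h', hFi c' hc']
  obtain ⟨L', hL'L, hSL', hL'⟩ := hL.exists_subseries v hnr hSL hScard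
  -- A member `g` outside `S` makes `n + 2` functions in a series of rank `n`, so they are dependent
  -- and each slope of `g` at `v` is at least one from `S`.
  have hL'x : ∀ g ∈ L', ∀ k, x k ≤ φ k (slope g (η k)) := by
    intro g hg k
    by_cases hgS : g ∈ S
    · obtain ⟨c, hc, rfl⟩ := hmem g hgS
      exact hFx c hc k
    · have hins : ↑(insert g S) ⊆ L' := by
        rw [Finset.coe_insert]
        exact Set.insert_subset hg hSL'
      obtain ⟨f, hf, hle⟩ := exists_slope_le_of_dependent
        (fun f hf => hL'.isTropicalLinearSeries.isPL (hins hf)) hinj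
        (hL'.isTropicalLinearSeries.dependent _ hins
          (by rw [Finset.card_insert_of_notMem hgS, hScard]))
        ((hη k).trans (hη i).symm)
      obtain ⟨c, hc, rfl⟩ := hmem f hf
      exact (hFx c hc k).trans ((hφ k).monotoneOn ⟨_, hFL c hc, rfl⟩ ⟨g, hL'L hg, rfl⟩ hle)
  have hsub : φ j '' slopes L' (η j) ⊆
      (fun y : Fin d → Fin (r + 1) => y j) '' DotArray.principal A x := by
    rintro _ ⟨_, ⟨g, hg, rfl⟩, rfl⟩
    exact ⟨fun k => φ k (slope g (η k)), ⟨(hA _).2 ⟨g, hL'L hg, fun _ => rfl⟩, hL'x g hg⟩, rfl⟩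
  have hslopes : slopes L' (η j) ⊆ slopes L (η j) := by
    rintro _ ⟨g, hg, rfl⟩
    exact ⟨g, hL'L hg, rfl⟩
  have hcard : (slopes L' (η j)).ncard = n + 1 := by
    rw [Set.ncard, hL'.isTropicalLinearSeries.encard_slopes (η j)]
    rfl
  rw [hn, ← hcard, ← ((hφ j).injOn.mono hslopes).ncard_image]
  exact Set.ncard_le_ncard hsub (Set.toFinite _)

end LocalArray

-- The theorem

end MetricGraph

open MetricGraph in
theorem mainTheorem2 {V E : Type*} [Finite V] [Finite E] (Γ : MetricGraph V E)
    (D : Γ.Point →₀ ℤ) (r : ℕ) (L : Set (Γ.Point → ℝ)) (hL : Γ.IsStronglyRecursive D r L)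
    (v : Γ.Point) (d : ℕ) (η : Fin d ≃ Γ.tangentsAt v) :
    (∀ i, (MetricGraph.slopes L (η i)).encard = r + 1) ∧
    ∃ P : DotArray r d, DotArray.IsPermutationArray P ∧
      MetricGraph.localArray L r (fun i => (η i : Γ.Tangent)) = DotArray.redundantClosure P := by
  have hT := hL.isTropicalLinearSeries
  have hcard : ∀ i, (slopes L (η i)).encard = r + 1 := fun i => hT.encard_slopes _
  refine ⟨hcard, ?_⟩
  choose φ hφ hφk using fun i => exists_strictMonoOn_index (hcard i)
  set A := localArray L r (fun i => (η i : Γ.Tangent)) with hAdef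
  have hA : ∀ x, x ∈ A ↔ ∃ f ∈ L, ∀ i, φ i (slope f (η i)) = x i := by
    intro x
    constructor
    · rintro ⟨f, hf, h⟩
      exact ⟨f, hf, fun i => (hφk i _ (h i).1 _).1 (h i).2⟩
    · rintro ⟨f, hf, h⟩
      exact ⟨f, hf, fun i => ⟨⟨f, hf, rfl⟩, (hφk i _ ⟨f, hf, rfl⟩ _).2 (h i)⟩⟩
  have hle := hL.ncard_image_principal_le (fun i => (η i).2) hφ hA
  have htot : DotArray.TotallyRankable A := by
    intro x
    rcases isEmpty_or_nonempty (Fin d) with hd | ⟨⟨i⟩⟩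
    -- With no axes, every array has every rank.
    · exact ⟨0, fun i => hd.elim i⟩
    · refine ⟨DotArray.axisRank (DotArray.principal A x) i, fun j => ?_⟩
      unfold DotArray.axisRank
      rw [(hle x i j).antisymm (hle x j i)]
  have hrank : DotArray.HasRank A r := by
    intro i
    have himg : (fun x : Fin d → Fin (r + 1) => x i) '' A = φ i '' slopes L (η i) := by
      apply Set.Subset.antisymm
      · rintro _ ⟨x, hx, rfl⟩
        obtain ⟨f, hf, h⟩ := (hA x).1 hx
        exact ⟨_, ⟨f, hf, rfl⟩, h i⟩
      · rintro _ ⟨_, ⟨f, hf, rfl⟩, rfl⟩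
        exact ⟨fun k => φ k (slope f (η k)), (hA _).2 ⟨f, hf, fun _ => rfl⟩, rfl⟩
    have hn : (slopes L (η i)).ncard = r + 1 := by
      rw [Set.ncard, hcard i]
      rfl
    rw [DotArray.axisRank, himg, (hφ i).injOn.ncard_image, hn]
    push_cast
    ring
  refine ⟨DotArray.core A, htot.isPermutationArray_core hrank,
    (htot.redundantClosure_core fun x hx y hy => ?_).symm⟩
  obtain ⟨f, hf, hfx⟩ := (hA x).1 hx
  obtain ⟨g, hg, hgy⟩ := (hA y).1 hy
  obtain ⟨h, hh, hs⟩ := hT.exists_slope_eq_min hf hg v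
  refine (hA _).2 ⟨h, hh, fun i => ?_⟩
  rw [hs _ (η i).2, (hφ i).monotoneOn.map_min ⟨f, hf, rfl⟩ ⟨g, hg, rfl⟩, hfx, hgy]
  rfl
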